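/- For real numbers $a_1,\dots,a_n$ and $1\le j\le n$, let $j\text{-}\min_{i\le n} a_i$ denote the $j$-th smallest of them, counted with multiplicity (so that $(j\text{-}\min_{i\le n} a_i)_{j=1}^n$ is the non-decreasing rearrangement of $(a_i)_{i=1}^n$). There is a universal constant $C>0$ such that the following holds. Let $1\le k<n$ be integers, let $X=(X_1,\dots,X_n)$ be a centered Gaussian random vector in $\mathbb{R}^n$ with independent coordinates (with possibly different, possibly zero, variances), let $T$ be an orthogonal transformation of $\mathbb{R}^n$, and set $Y=T(X)$. Then $$ \mathbb{E}\sum_{j=1}^k j\text{-}\min_{i\le n} X_i^2 \;\le\; C\,\mathbb{E}\sum_{j=1}^k j\text{-}\min_{i\le n} Y_i^2 , $$ both expectations being finite. -/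

import Mathlib

open MeasureTheory ProbabilityTheory

/-- The entry at (0-based) position `j` of the non-decreasing rearrangement of `a`;
that is, the `(j+1)`-th smallest element of `a`, counted with multiplicity. -/
noncomputable def jMin {n : ℕ} (a : Fin n → ℝ) (j : Fin n) : ℝ :=
  a (Tuple.sort a j)

/-- The sum of the `k` smallest elements of `a` (counted with multiplicity), for `k ≤ n`. -/
noncomputable def sumJMin {n : ℕ} (k : ℕ) (a : Fin n → ℝ) : ℝ :=
  ∑ j ∈ Finset.univ.filter (fun j : Fin n => j.val < k), jMin a j

/-!
Let `t` be the threshold at which the expected number of `i` with `|X i| ≤ t` is exactly `k` (if at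
least `k` variances vanish, the left-hand side is zero). Both expectations are compared with
`M = ∑ i, E[X i ^ 2; |X i| ≤ t]`.

*Lower bound for `Y`.* For every real `c`, the sum of the `k` smallest entries of `a` is at least
`k * c - ∑ i, (c - a i)⁺`. Take `c = t ^ 2` and `a i = Y i ^ 2`. The variances of the coordinates of
`Y = T X` are averages of those of `X` under the doubly stochastic matrix of the squared entries of
`T`, and `E (t ^ 2 - σ ^ 2 g ^ 2)⁺` is convex in `σ ^ 2`, so replacing `Y` by `X` only decreases the
bound. For `X` it equals `M` by the choice of `t`.

*Upper bound for `X`.* A coordinate with standard deviation `σ ≤ 2 t` contributes `σ ^ 2` to `M` up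
to a constant. For each of the remaining coordinates `P(|X i| ≤ t) ≤ t / σ i`, so if `l` of the `k`
minima are still needed, these quotients sum to at least `l`. They are all bounded by `1 / 2`, hence
the coordinates can be grouped into `l` disjoint sets over each of which the `t / σ i` sum to at
least a constant. By independence the tail probabilities multiply over a group, so the minimum of
`X i ^ 2` over it has expectation at most a constant times `t ^ 2`, while `l * t ^ 2` is at most a
constant times the contribution of these coordinates to `M`.
-/

open Filter Finset
open scoped Matrix NNReal Topology

/-! ### Sums of the smallest entries -/

section SumOfSmallest

variable {n k : ℕ}

lemma monotone_jMin (a : Fin n → ℝ) : Monotone (jMin a) :=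
  Tuple.monotone_sort a

lemma sum_comp_jMin (a : Fin n → ℝ) (f : ℝ → ℝ) : ∑ j, f (jMin a j) = ∑ i, f (a i) :=
  Equiv.sum_comp (Tuple.sort a) fun i => f (a i)

lemma sumJMin_nonneg (k : ℕ) {a : Fin n → ℝ} (ha : ∀ i, 0 ≤ a i) : 0 ≤ sumJMin k a :=
  sum_nonneg fun _ _ => ha _

lemma sum_sub_jMin (hk : k ≤ n) (a : Fin n → ℝ) (c : ℝ) :
    ∑ j : Fin n with j.val < k, (c - jMin a j) = k * c - sumJMin k a := by
  rw [sum_sub_distrib, sum_const, Fin.card_filter_val_lt, min_eq_right hk, nsmul_eq_mul, sumJMin]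

lemma mul_sub_sum_posPart_le_sumJMin (hk : k ≤ n) (a : Fin n → ℝ) (c : ℝ) :
    k * c - ∑ i, max (c - a i) 0 ≤ sumJMin k a := by
  have hsum : ∑ j : Fin n with j.val < k, (c - jMin a j) ≤ ∑ i, max (c - a i) 0 :=
    calc _ ≤ ∑ j : Fin n with j.val < k, max (c - jMin a j) 0 :=
          sum_le_sum fun _ _ => le_max_left _ _
      _ ≤ ∑ j, max (c - jMin a j) 0 :=
          sum_le_sum_of_subset_of_nonneg (filter_subset _ _) fun _ _ _ => le_max_right _ _
      _ = _ := sum_comp_jMin a fun x => max (c - x) 0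
  rw [sum_sub_jMin hk] at hsum
  linarith

lemma exists_sumJMin_eq_mul_sub_sum_posPart (hk₀ : 0 < k) (hk : k ≤ n) (a : Fin n → ℝ) :
    ∃ c, sumJMin k a = k * c - ∑ i, max (c - a i) 0 := by
  set last : Fin n := ⟨k - 1, by omega⟩
  refine ⟨jMin a last, ?_⟩
  have hsum : ∑ j : Fin n with j.val < k, (jMin a last - jMin a j)
      = ∑ i, max (jMin a last - a i) 0 := by
    rw [← sum_comp_jMin a fun x => max (jMin a last - x) 0, sum_filter]
    refine sum_congr rfl fun j _ => ?_
    split_ifs with hj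
    · exact (max_eq_left (sub_nonneg.2 (monotone_jMin a (Nat.le_sub_one_of_lt hj)))).symm
    · exact (max_eq_right (sub_nonpos.2
        (monotone_jMin a ((Nat.sub_le k 1).trans (not_lt.1 hj))))).symm
  rw [sum_sub_jMin hk] at hsum
  linarith

lemma sumJMin_card_le_sum (a : Fin n → ℝ) (K : Finset (Fin n)) :
    sumJMin #K a ≤ ∑ i ∈ K, a i := by
  rcases K.eq_empty_or_nonempty with rfl | hK
  · simp [sumJMin]
  obtain ⟨c, hc⟩ := exists_sumJMin_eq_mul_sub_sum_posPart hK.card_pos (card_finset_fin_le K) a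
  have hsum : ∑ i ∈ K, (c - a i) ≤ ∑ i, max (c - a i) 0 :=
    (sum_le_sum fun _ _ => le_max_left _ _).trans
      (sum_le_sum_of_subset_of_nonneg (subset_univ K) fun _ _ _ => le_max_right _ _)
  rw [sum_sub_distrib, sum_const, nsmul_eq_mul] at hsum
  linarith

lemma exists_card_eq_sumJMin_eq (hk : k ≤ n) (a : Fin n → ℝ) :
    ∃ K : Finset (Fin n), #K = k ∧ sumJMin k a = ∑ i ∈ K, a i :=
  ⟨({j : Fin n | j.val < k} : Finset (Fin n)).map (Tuple.sort a).toEmbedding,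
    by rw [card_map, Fin.card_filter_val_lt, min_eq_right hk], by rw [sum_map]; rfl⟩

lemma sumJMin_eq_inf' (hk : k ≤ n) (a : Fin n → ℝ) :
    sumJMin k a = (powersetCard k (univ : Finset (Fin n))).inf'
      (powersetCard_nonempty.2 (by simpa using hk)) fun K => ∑ i ∈ K, a i := by
  apply le_antisymm
  · refine le_inf' _ _ fun K hK => ?_
    obtain rfl := (mem_powersetCard.1 hK).2
    exact sumJMin_card_le_sum a K
  · obtain ⟨K, hK, hsum⟩ := exists_card_eq_sumJMin_eq hk a
    rw [hsum]
    exact inf'_le _ (mem_powersetCard.2 ⟨subset_univ _, hK⟩)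

lemma sumJMin_card_add_card_le {κ : Type*} [Fintype κ] (a : Fin n → ℝ) {I : Finset (Fin n)}
    {S : κ → Finset (Fin n)} (hS : ∀ j, (S j).Nonempty)
    (hdisj : Pairwise (Function.onFun Disjoint S)) (hI : ∀ j, Disjoint I (S j)) :
    sumJMin (#I + Fintype.card κ) a ≤ ∑ i ∈ I, a i + ∑ j, (S j).inf' (hS j) a := by
  choose m hm hmin using fun j => exists_mem_eq_inf' (hS j) a
  have hinj : Function.Injective m := fun j j' h => by
    by_contra hne
    exact disjoint_left.1 (hdisj hne) (hm j) (h ▸ hm j')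
  have hIm : Disjoint I (univ.map ⟨m, hinj⟩) := by
    simp only [disjoint_right, Finset.mem_map, mem_univ, true_and, forall_exists_index]
    rintro _ j rfl
    exact disjoint_right.1 (hI j) (hm j)
  have h := sumJMin_card_le_sum a (I.disjUnion _ hIm)
  rw [card_disjUnion, card_map, card_univ, sum_disjUnion, sum_map] at h
  simpa only [hmin, Function.Embedding.coeFn_mk] using h

end SumOfSmallest

/-! ### Integrals of sums of the smallest entries -/

section Integral

variable {Ω : Type*} [MeasurableSpace Ω] {P : Measure Ω} {n k : ℕ}

lemma integrable_inf' {ι : Type*} {S : Finset ι} (hS : S.Nonempty) {f : ι → Ω → ℝ}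
    (hf : ∀ i ∈ S, Integrable (f i) P) : Integrable (fun ω => S.inf' hS fun i => f i ω) P := by
  have h : Integrable (S.inf' hS f) P :=
    inf'_induction hS f (p := (Integrable · P)) (fun _ h₁ _ h₂ => h₁.inf h₂) hf
  exact h.congr (.of_forall fun ω => Finset.inf'_apply hS f ω)

lemma integrable_sumJMin (hk : k ≤ n) {a : Fin n → Ω → ℝ} (ha : ∀ i, Integrable (a i) P) :
    Integrable (fun ω => sumJMin k fun i => a i ω) P := by
  simp only [sumJMin_eq_inf' hk]
  exact integrable_inf' _ fun K _ => integrable_finsetSum K fun i _ => ha i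

lemma integral_sumJMin_card_le_sum {a : Fin n → Ω → ℝ} (ha : ∀ i, Integrable (a i) P)
    (K : Finset (Fin n)) :
    ∫ ω, sumJMin #K (fun i => a i ω) ∂P ≤ ∑ i ∈ K, ∫ ω, a i ω ∂P := by
  rw [← integral_finsetSum K fun i _ => ha i]
  exact integral_mono (integrable_sumJMin (card_finset_fin_le K) ha)
    (integrable_finsetSum K fun i _ => ha i) fun ω => sumJMin_card_le_sum _ K

lemma mul_sub_sum_integral_posPart_le_integral_sumJMin [IsProbabilityMeasure P] (hk : k ≤ n)
    {a : Fin n → Ω → ℝ} (ha : ∀ i, Integrable (a i) P) (c : ℝ) :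
    k * c - ∑ i, ∫ ω, max (c - a i ω) 0 ∂P ≤ ∫ ω, sumJMin k (fun i => a i ω) ∂P := by
  have hpos i : Integrable (fun ω => max (c - a i ω) 0) P :=
    ((integrable_const c).sub (ha i)).pos_part
  have hsum : Integrable (fun ω => ∑ i, max (c - a i ω) 0) P :=
    integrable_finsetSum _ fun i _ => hpos i
  calc _ = ∫ ω, (k * c - ∑ i, max (c - a i ω) 0) ∂P := by
        rw [integral_sub (integrable_const _) hsum, integral_finsetSum _ fun i _ => hpos i,
          integral_const, probReal_univ, one_smul]
    _ ≤ _ := integral_mono ((integrable_const _).sub hsum) (integrable_sumJMin hk ha)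
        fun ω => mul_sub_sum_posPart_le_sumJMin hk _ c

end Integral

/-! ### Symmetric intervals -/

section SymmetricInterval

/-- The part of the second moment of `μ` carried by `[-t, t]`. -/
noncomputable def truncSecondMoment (μ : Measure ℝ) (t : ℝ) : ℝ :=
  ∫ x in Set.Icc (-t) t, x ^ 2 ∂μ

lemma truncSecondMoment_nonneg (μ : Measure ℝ) (t : ℝ) : 0 ≤ truncSecondMoment μ t :=
  integral_nonneg fun x => sq_nonneg x

lemma monotone_symmIcc : Monotone fun t : ℝ => Set.Icc (-t) t :=
  fun _ _ h => Set.Icc_subset_Icc (neg_le_neg h) h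

lemma monotone_truncSecondMoment {μ : Measure ℝ} (hμ : Integrable (fun x => x ^ 2) μ) :
    Monotone (truncSecondMoment μ) := fun _ _ h =>
  setIntegral_mono_set hμ.integrableOn (.of_forall sq_nonneg) (monotone_symmIcc h).eventuallyLE

lemma integral_posPart_sq_sub_sq {μ : Measure ℝ} [IsFiniteMeasure μ]
    (hμ : Integrable (fun x => x ^ 2) μ) {t : ℝ} (ht : 0 ≤ t) :
    ∫ x, max (t ^ 2 - x ^ 2) 0 ∂μ
      = t ^ 2 * μ.real (Set.Icc (-t) t) - truncSecondMoment μ t := by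
  have hind : (fun x => max (t ^ 2 - x ^ 2) 0)
      = (Set.Icc (-t) t).indicator fun x => t ^ 2 - x ^ 2 := by
    ext x
    by_cases hx : x ∈ Set.Icc (-t) t
    · rw [Set.indicator_of_mem hx,
        max_eq_left (sub_nonneg.2 (sq_le_sq' hx.1 hx.2))]
    · rw [Set.indicator_of_notMem hx, max_eq_right (sub_nonpos.2 ?_)]
      rw [Set.mem_Icc, ← abs_le, not_le] at hx
      exact sq_le_sq.2 ((abs_of_nonneg ht).trans_le hx.le)
  rw [hind, integral_indicator measurableSet_Icc,
    integral_sub (integrable_const _) hμ.integrableOn, setIntegral_const, smul_eq_mul, mul_comm,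
    truncSecondMoment]

lemma continuousOn_measureReal_symmIcc_of_nullSingletonClass (μ : Measure ℝ) [IsFiniteMeasure μ]
    [NullSingletonClass μ] : ContinuousOn (fun t => μ.real (Set.Icc (-t) t)) (Set.Ici 0) := by
  have hprim : Continuous fun t : ℝ => ∫ _ in (0 : ℝ)..t, (1 : ℝ) ∂μ :=
    (integrable_const 1).continuous_primitive 0
  refine (hprim.sub (hprim.comp continuous_neg)).continuousOn.congr fun t ht => ?_
  have hle : -t ≤ t := neg_le_self ht
  simp only [Pi.sub_apply, Function.comp_apply]
  rw [intervalIntegral.integral_interval_sub_left intervalIntegrable_const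
    intervalIntegrable_const, intervalIntegral.integral_of_le hle, setIntegral_const, smul_eq_mul,
    mul_one, measureReal_congr Ioc_ae_eq_Icc]

lemma tendsto_measureReal_symmIcc (μ : Measure ℝ) [IsFiniteMeasure μ] :
    Tendsto (fun t => μ.real (Set.Icc (-t) t)) atTop (𝓝 (μ.real Set.univ)) := by
  have hU : ⋃ t : ℝ, Set.Icc (-t) t = Set.univ :=
    Set.iUnion_eq_univ_iff.2 fun x => ⟨|x|, abs_le.1 le_rfl⟩
  rw [← hU]
  exact (ENNReal.tendsto_toReal (measure_ne_top _ _)).comp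
    (tendsto_measure_iUnion_atTop monotone_symmIcc)

lemma continuousOn_measureReal_symmIcc {μ : Measure ℝ} [IsFiniteMeasure μ]
    (hμ : ∀ x ≠ 0, μ {x} = 0) : ContinuousOn (fun t => μ.real (Set.Icc (-t) t)) (Set.Ici 0) := by
  have hnull : NullSingletonClass (μ.restrict {0}ᶜ) := ⟨fun x => by
    rcases eq_or_ne x 0 with rfl | hx
    · simp
    · exact nonpos_iff_eq_zero.1 ((Measure.restrict_apply_le _ _).trans_eq (hμ x hx))⟩
  refine ((continuousOn_measureReal_symmIcc_of_nullSingletonClass (μ.restrict {0}ᶜ)).const_add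
    (μ.real {0})).congr fun t ht => ?_
  have h₀ : {0} ⊆ Set.Icc (-t) t := Set.singleton_subset_iff.2 ⟨neg_nonpos.2 ht, ht⟩
  beta_reduce
  rw [measureReal_restrict_apply measurableSet_Icc, ← Set.sdiff_eq,
    ← measureReal_inter_add_sdiff (s := Set.Icc (-t) t) (measurableSet_singleton 0),
    Set.inter_eq_right.2 h₀]

lemma exists_sum_measureReal_symmIcc_eq {ι : Type*} [Fintype ι] {μ : ι → Measure ℝ}
    [∀ i, IsProbabilityMeasure (μ i)] (hμ : ∀ i, ∀ x ≠ 0, μ i {x} = 0) {c : ℝ}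
    (h₀ : ∑ i, (μ i).real {0} < c) (hc : c < Fintype.card ι) :
    ∃ t > 0, ∑ i, (μ i).real (Set.Icc (-t) t) = c := by
  set F : ℝ → ℝ := fun t => ∑ i, (μ i).real (Set.Icc (-t) t)
  have hF₀ : F 0 < c := by simpa [F] using h₀
  have hFtop : Tendsto F atTop (𝓝 (Fintype.card ι)) := by
    simpa using tendsto_finsetSum univ fun i _ => tendsto_measureReal_symmIcc (μ i)
  obtain ⟨b, hcb, hb⟩ := ((hFtop.eventually_const_lt hc).and (eventually_ge_atTop 0)).exists
  have hcont : ContinuousOn F (Set.Icc 0 b) := continuousOn_finsetSum _ fun i _ =>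
    (continuousOn_measureReal_symmIcc (hμ i)).mono Set.Icc_subset_Ici_self
  obtain ⟨t, ht, rfl⟩ := intermediate_value_Icc hb hcont ⟨hF₀.le, hcb.le⟩
  exact ⟨t, ht.1.lt_of_ne (by rintro rfl; exact hF₀.false), rfl⟩

end SymmetricInterval

/-! ### Centred Gaussian measures -/

section Gaussian

variable {v : ℝ≥0} {t : ℝ}

lemma integrable_sq_gaussianReal (m : ℝ) (v : ℝ≥0) :
    Integrable (fun x => x ^ 2) (gaussianReal m v) :=
  (memLp_id_gaussianReal 2).integrable_sq

lemma integral_sq_gaussianReal_zero (v : ℝ≥0) : ∫ x, x ^ 2 ∂gaussianReal 0 v = v := by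
  rw [← variance_fun_id_gaussianReal (μ := 0) (v := v),
    variance_of_integral_eq_zero aemeasurable_id' integral_id_gaussianReal]

lemma gaussianPDFReal_le (m : ℝ) (v : ℝ≥0) (x : ℝ) : gaussianPDFReal m v x ≤ 1 / (2 * √v) := by
  have hsqrt : 2 * √v ≤ √(2 * Real.pi * v) := by
    rw [Real.sqrt_mul (by positivity)]
    gcongr
    exact Real.le_sqrt_of_sq_le (by linarith [Real.pi_gt_three])
  rcases eq_or_ne v 0 with rfl | hv
  · simp
  calc gaussianPDFReal m v x ≤ (√(2 * Real.pi * v))⁻¹ * 1 := by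
        unfold gaussianPDFReal
        gcongr
        exact Real.exp_le_one_iff.2 (div_nonpos_of_nonpos_of_nonneg
          (neg_nonpos.2 (sq_nonneg _)) (by positivity))
    _ ≤ 1 / (2 * √v) := by
        rw [mul_one, ← one_div]
        gcongr

lemma le_gaussianPDFReal_zero {x : ℝ} (hx : |x| ≤ 2 * √v) :
    1 / (24 * √v) ≤ gaussianPDFReal 0 v x := by
  rcases eq_or_ne v 0 with rfl | hv
  · simp
  have hv' : (0 : ℝ) < v := by positivity
  have hsqrt : √(2 * Real.pi * v) ≤ 3 * √v := by
    rw [Real.sqrt_mul (by positivity)]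
    gcongr
    exact Real.sqrt_le_iff.2 ⟨by norm_num, by linarith [Real.pi_lt_four]⟩
  have hexp : 1 / 8 ≤ Real.exp (-2) := by
    have hexp₁ := Real.exp_one_lt_d9
    rw [Real.exp_neg, ← one_div]
    refine one_div_le_one_div_of_le (Real.exp_pos 2) ?_
    rw [show (2 : ℝ) = 1 + 1 by norm_num, Real.exp_add]
    nlinarith [Real.exp_pos 1]
  have hexp' : Real.exp (-2) ≤ Real.exp (-(x - 0) ^ 2 / (2 * v)) := by
    rw [Real.exp_le_exp, le_div_iff₀ (by positivity), sub_zero]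
    have := sq_le_sq' (abs_le.1 hx).1 (abs_le.1 hx).2
    rw [mul_pow, Real.sq_sqrt hv'.le] at this
    linarith
  calc 1 / (24 * √v) = (3 * √v)⁻¹ * (1 / 8) := by field_simp; norm_num
    _ ≤ (√(2 * Real.pi * v))⁻¹ * Real.exp (-(x - 0) ^ 2 / (2 * v)) := by
        gcongr
        exact hexp.trans hexp'

lemma setIntegral_gaussianReal {m : ℝ} (hv : v ≠ 0) (f : ℝ → ℝ) {s : Set ℝ}
    (hs : MeasurableSet s) :
    ∫ x in s, f x ∂gaussianReal m v = ∫ x in s, gaussianPDFReal m v x * f x := by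
  rw [← integral_indicator hs, integral_gaussianReal_eq_integral_smul hv, ← integral_indicator hs]
  congr with x
  by_cases hx : x ∈ s <;> simp [hx]

lemma measureReal_symmIcc_gaussianReal_le (m : ℝ) (hv : v ≠ 0) (ht : 0 ≤ t) :
    (gaussianReal m v).real (Set.Icc (-t) t) ≤ t / √v := by
  calc (gaussianReal m v).real (Set.Icc (-t) t)
      = ∫ x in Set.Icc (-t) t, gaussianPDFReal m v x := by
        rw [measureReal_def, gaussianReal_apply_eq_integral m hv, ENNReal.toReal_ofReal
          (integral_nonneg fun x => gaussianPDFReal_nonneg m v x)]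
    _ ≤ ∫ _ in Set.Icc (-t) t, 1 / (2 * √v) :=
        integral_mono (integrable_gaussianPDFReal m v).integrableOn (integrable_const _)
          (gaussianPDFReal_le m v)
    _ = t / √v := by
        rw [setIntegral_const, Real.volume_real_Icc_of_le (neg_le_self ht), smul_eq_mul]
        field_simp
        ring

lemma mul_intervalIntegral_le_setIntegral_gaussianReal (ht : 0 ≤ t) (htv : t ≤ 2 * √v)
    {f : ℝ → ℝ} (hf : Continuous f) (hf₀ : ∀ x, 0 ≤ f x) :
    1 / (24 * √v) * ∫ x in -t..t, f x ≤ ∫ x in Set.Icc (-t) t, f x ∂gaussianReal 0 v := by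
  rcases eq_or_ne v 0 with rfl | hv
  · simpa using integral_nonneg hf₀
  have hpdf : Continuous (gaussianPDFReal 0 v) := by unfold gaussianPDFReal; fun_prop
  rw [setIntegral_gaussianReal hv f measurableSet_Icc,
    intervalIntegral.integral_of_le (neg_le_self ht), ← integral_Icc_eq_integral_Ioc,
    ← integral_const_mul]
  refine setIntegral_mono_on (by fun_prop : Continuous _).continuousOn.integrableOn_Icc
    (hpdf.mul hf).continuousOn.integrableOn_Icc measurableSet_Icc fun x hx => ?_
  exact mul_le_mul_of_nonneg_right (le_gaussianPDFReal_zero ((abs_le.2 hx).trans htv)) (hf₀ x)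

lemma div_le_measureReal_symmIcc_gaussianReal (ht : 0 ≤ t) (htv : t ≤ 2 * √v) :
    t / (12 * √v) ≤ (gaussianReal 0 v).real (Set.Icc (-t) t) := by
  have h := mul_intervalIntegral_le_setIntegral_gaussianReal ht htv continuous_const
    fun _ => zero_le_one
  rw [setIntegral_const, smul_eq_mul, mul_one, intervalIntegral.integral_const] at h
  refine le_of_eq_of_le ?_ h
  rw [smul_eq_mul]
  field_simp
  ring

lemma sq_mul_div_le_truncSecondMoment_gaussianReal (ht : 0 ≤ t) (htv : t ≤ 2 * √v) :
    t ^ 2 * (t / √v) ≤ 36 * truncSecondMoment (gaussianReal 0 v) t := by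
  have h := mul_intervalIntegral_le_setIntegral_gaussianReal ht htv (continuous_pow 2) sq_nonneg
  rw [integral_pow] at h
  calc t ^ 2 * (t / √v)
      = 36 * (1 / (24 * √v) * ((t ^ (2 + 1) - (-t) ^ (2 + 1)) / ((2 : ℕ) + 1))) := by
        push_cast
        field_simp
        ring
    _ ≤ _ := mul_le_mul_of_nonneg_left h (by norm_num)

lemma le_mul_truncSecondMoment_gaussianReal (hvt : √v ≤ 2 * t) :
    v ≤ 288 * truncSecondMoment (gaussianReal 0 v) t := by
  have hhalf := sq_mul_div_le_truncSecondMoment_gaussianReal (v := v) (t := √v / 2) (by positivity)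
    (by linarith [Real.sqrt_nonneg v])
  have hmono := monotone_truncSecondMoment (integrable_sq_gaussianReal 0 v)
    (show √v / 2 ≤ t by linarith)
  have hpow : (√v / 2) ^ 2 * (√v / 2 / √v) = v / 8 := by
    rcases eq_or_ne v 0 with rfl | hv
    · simp
    have hv' : (0 : ℝ) < v := by positivity
    field_simp
    rw [Real.sq_sqrt hv'.le]
    ring
  linarith

lemma hasSubgaussianMGF_id_gaussianReal (v : ℝ≥0) : HasSubgaussianMGF id v (gaussianReal 0 v) where
  integrable_exp_mul := integrable_exp_mul_gaussianReal
  mgf_le u := by simp [mgf_id_gaussianReal]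

lemma measureReal_compl_symmIcc_gaussianReal_le (v : ℝ≥0) (ht : 0 ≤ t) :
    (gaussianReal 0 v).real (Set.Icc (-t) t)ᶜ ≤ 2 * Real.exp (-t ^ 2 / (2 * v)) := by
  have hsub : (Set.Icc (-t) t)ᶜ ⊆ {x | t ≤ id x} ∪ {x | t ≤ (-id) x} := by
    intro x hx
    rw [Set.mem_compl_iff, Set.mem_Icc, ← abs_le, not_le, lt_abs] at hx
    exact hx.imp le_of_lt le_of_lt
  calc _ ≤ _ := measureReal_mono hsub
    _ ≤ _ := measureReal_union_le _ _
    _ ≤ Real.exp (-t ^ 2 / (2 * v)) + Real.exp (-t ^ 2 / (2 * v)) :=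
        add_le_add ((hasSubgaussianMGF_id_gaussianReal v).measure_ge_le ht)
          ((hasSubgaussianMGF_id_gaussianReal v).neg.measure_ge_le ht)
    _ = _ := (two_mul _).symm

-- For `t ≤ 2 √v` the mass `t / (12 √v)` of `[-t, t]` suffices; beyond, the sub-Gaussian tail does.
lemma measureReal_compl_symmIcc_gaussianReal_le_exp (v : ℝ≥0) (ht : 0 ≤ t) :
    (gaussianReal 0 v).real (Set.Icc (-t) t)ᶜ ≤ Real.exp (-(t / (12 * √v))) := by
  rcases le_total t (2 * √v) with htv | htv
  · rw [probReal_compl_eq_one_sub measurableSet_Icc]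
    linarith [div_le_measureReal_symmIcc_gaussianReal ht htv,
      Real.add_one_le_exp (-(t / (12 * √v)))]
  rcases eq_or_ne v 0 with rfl | hv
  · simp
  set r := t / √v with hr
  have hr₂ : 2 ≤ r := (le_div_iff₀ (by positivity)).2 htv
  calc _ ≤ 2 * Real.exp (-t ^ 2 / (2 * v)) := measureReal_compl_symmIcc_gaussianReal_le v ht
    _ = 2 * Real.exp (-(r ^ 2 / 2)) := by
        rw [hr, div_pow, Real.sq_sqrt v.coe_nonneg]
        congr 2
        field_simp
    _ ≤ Real.exp 1 * Real.exp (-(r ^ 2 / 2)) := by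
        gcongr
        linarith [Real.add_one_le_exp 1]
    _ = Real.exp (1 - r ^ 2 / 2) := by rw [← Real.exp_add, sub_eq_add_neg]
    _ ≤ Real.exp (-(r / 12)) := Real.exp_le_exp.2 (by nlinarith)
    _ = _ := by rw [hr, div_div, mul_comm]

lemma measureReal_lt_sq_le_exp_of_hasLaw {Ω : Type*} [MeasurableSpace Ω] {P : Measure Ω}
    {X : Ω → ℝ} (hX : HasLaw X (gaussianReal 0 v) P) {u : ℝ} (hu : 0 ≤ u) :
    P.real {ω | u < X ω ^ 2} ≤ Real.exp (-(1 / (12 * √v) * √u)) := by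
  have hset : {x : ℝ | u < x ^ 2} = (Set.Icc (-√u) √u)ᶜ := by
    ext x
    rw [Set.mem_compl_iff, Set.mem_Icc, ← abs_le, not_le, ← Real.sqrt_sq_eq_abs,
      Real.sqrt_lt_sqrt_iff hu, Set.mem_ofPred_eq]
  rw [hX.measureReal_eq (p := fun x => u < x ^ 2) (hset ▸ measurableSet_Icc.compl), hset,
    one_div_mul_eq_div]
  exact measureReal_compl_symmIcc_gaussianReal_le_exp v (Real.sqrt_nonneg u)

lemma gaussianReal_zero_singleton_of_ne (v : ℝ≥0) {x : ℝ} (hx : x ≠ 0) :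
    gaussianReal 0 v {x} = 0 := by
  rcases eq_or_ne v 0 with rfl | hv
  · simp [hx.symm]
  · have := nullSingletonClass_gaussianReal (μ := 0) hv
    exact measure_singleton x

lemma measureReal_singleton_zero_gaussianReal (v : ℝ≥0) :
    (gaussianReal 0 v).real {0} = if v = 0 then 1 else 0 := by
  split_ifs with hv
  · simp [hv, measureReal_def]
  · have := nullSingletonClass_gaussianReal (μ := 0) hv
    simp [measureReal_def]

lemma exists_sum_measureReal_symmIcc_gaussianReal_eq {ι : Type*} [Fintype ι] {v : ι → ℝ≥0} {k : ℕ}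
    (h₀ : #{i | v i = 0} < k) (hk : k < Fintype.card ι) :
    ∃ t > 0, ∑ i, (gaussianReal 0 (v i)).real (Set.Icc (-t) t) = k := by
  refine exists_sum_measureReal_symmIcc_eq (fun i x => gaussianReal_zero_singleton_of_ne (v i)) ?_
    (mod_cast hk)
  simpa only [measureReal_singleton_zero_gaussianReal, sum_boole] using mod_cast h₀

end Gaussian

/-! ### Minima of independent variables -/

lemma integral_exp_neg_mul_sqrt {b : ℝ} (hb : 0 < b) :
    ∫ u in Set.Ioi 0, Real.exp (-(b * √u)) = 2 / b ^ 2 := by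
  have h := integral_exp_neg_mul_rpow (p := 1 / 2) (by norm_num) hb
  simp only [← Real.sqrt_eq_rpow, neg_mul] at h
  rw [h, show (-1 / (1 / 2) : ℝ) = -(2 : ℕ) by norm_num, Real.rpow_neg hb.le, Real.rpow_natCast,
    show (1 / (1 / 2) + 1 : ℝ) = (2 : ℕ) + 1 by norm_num, Real.Gamma_nat_eq_factorial,
    Nat.factorial_two, Nat.cast_two, inv_mul_eq_div]

lemma integrableOn_exp_neg_mul_sqrt {b : ℝ} (hb : 0 < b) :
    IntegrableOn (fun u => Real.exp (-(b * √u))) (Set.Ioi 0) := by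
  simpa only [Real.rpow_zero, one_mul, neg_mul, ← Real.sqrt_eq_rpow] using
    integrableOn_rpow_mul_exp_neg_mul_rpow (s := 0) (p := 1 / 2) (by norm_num) (by norm_num) hb

section Minimum

variable {Ω ι : Type*} [MeasurableSpace Ω] {P : Measure Ω}

lemma integral_le_of_measureReal_lt_le_exp_neg_sqrt {Z : Ω → ℝ} (hZ : Integrable Z P)
    (hZ₀ : 0 ≤ᵐ[P] Z) {b : ℝ} (hb : 0 < b)
    (htail : ∀ u > 0, P.real {ω | u < Z ω} ≤ Real.exp (-(b * √u))) :
    ∫ ω, Z ω ∂P ≤ 2 / b ^ 2 := by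
  rw [hZ.integral_eq_integral_meas_lt hZ₀, ← integral_exp_neg_mul_sqrt hb]
  refine integral_mono_of_nonneg (.of_forall fun _ => measureReal_nonneg)
    (integrableOn_exp_neg_mul_sqrt hb) ?_
  filter_upwards [ae_restrict_mem measurableSet_Ioi] with u hu using htail u hu

lemma measureReal_lt_inf'_eq_prod {Z : ι → Ω → ℝ} (hZ : iIndepFun Z P) {S : Finset ι}
    (hS : S.Nonempty) (u : ℝ) :
    P.real {ω | u < S.inf' hS fun i => Z i ω} = ∏ i ∈ S, P.real {ω | u < Z i ω} := by
  have hset : {ω | u < S.inf' hS fun i => Z i ω} = ⋂ i ∈ S, Z i ⁻¹' Set.Ioi u := by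
    ext ω
    simp only [lt_inf'_iff, Set.mem_ofPred_eq, Set.mem_iInter, Set.mem_preimage, Set.mem_Ioi]
  rw [hset, measureReal_def, iIndepFun_iff_measure_inter_preimage_eq_mul.1 hZ S
    fun _ _ => measurableSet_Ioi, ENNReal.toReal_prod]
  rfl

lemma integral_inf'_le_of_measureReal_lt_le_exp_neg_sqrt {Z : ι → Ω → ℝ} (hind : iIndepFun Z P)
    {S : Finset ι} (hS : S.Nonempty) (hZ : ∀ i ∈ S, Integrable (Z i) P)
    (hZ₀ : ∀ i ∈ S, ∀ ω, 0 ≤ Z i ω) {rate : ι → ℝ}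
    (htail : ∀ i ∈ S, ∀ u > 0, P.real {ω | u < Z i ω} ≤ Real.exp (-(rate i * √u)))
    {b : ℝ} (hb : 0 < b) (hbS : b ≤ ∑ i ∈ S, rate i) :
    ∫ ω, S.inf' hS (fun i => Z i ω) ∂P ≤ 2 / b ^ 2 := by
  refine integral_le_of_measureReal_lt_le_exp_neg_sqrt (integrable_inf' hS hZ)
    (.of_forall fun ω => le_inf' _ _ fun i hi => hZ₀ i hi ω) hb fun u hu => ?_
  calc _ = ∏ i ∈ S, P.real {ω | u < Z i ω} := measureReal_lt_inf'_eq_prod hind hS u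
    _ ≤ ∏ i ∈ S, Real.exp (-(rate i * √u)) :=
        prod_le_prod (fun _ _ => measureReal_nonneg) fun i hi => htail i hi u hu
    _ = Real.exp (-((∑ i ∈ S, rate i) * √u)) := by
        rw [← Real.exp_sum, sum_neg_distrib, sum_mul]
    _ ≤ _ := by gcongr

end Minimum

lemma exists_subset_sum_mem_Icc {ι : Type*} {x : ι → ℝ} {b : ℝ} {J : Finset ι}
    (hx : ∀ i ∈ J, x i ≤ b) (hb : 0 ≤ b) (hJ : b ≤ ∑ i ∈ J, x i) :
    ∃ S ⊆ J, ∑ i ∈ S, x i ∈ Set.Icc b (2 * b) := by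
  classical
  induction J using Finset.induction_on with
  | empty => exact ⟨∅, subset_rfl, hJ, by simpa using hb⟩
  | insert a J ha ih =>
    rcases le_or_gt b (∑ i ∈ J, x i) with hbJ | hbJ
    · obtain ⟨S, hSJ, hS⟩ := ih (fun i hi => hx i (mem_insert_of_mem hi)) hbJ
      exact ⟨S, hSJ.trans (subset_insert a J), hS⟩
    · refine ⟨insert a J, subset_rfl, hJ, ?_⟩
      rw [sum_insert ha]
      linarith [hx a (mem_insert_self a J)]

lemma exists_disjoint_subsets_le_sum {ι : Type*} {x : ι → ℝ} {b : ℝ} (hb : 0 ≤ b) (l : ℕ)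
    {J : Finset ι} (hx : ∀ i ∈ J, x i ≤ b) (hJ : 2 * b * l ≤ ∑ i ∈ J, x i) :
    ∃ S : Fin l → Finset ι, Pairwise (Function.onFun Disjoint S) ∧
      ∀ j, S j ⊆ J ∧ b ≤ ∑ i ∈ S j, x i := by
  classical
  induction l generalizing J with
  | zero => exact ⟨Fin.elim0, fun j => j.elim0, fun j => j.elim0⟩
  | succ l ih =>
    push_cast at hJ
    obtain ⟨S₀, hS₀J, hbS₀, hS₀b⟩ := exists_subset_sum_mem_Icc hx hb (by nlinarith)
    have hrest : 2 * b * l ≤ ∑ i ∈ J \ S₀, x i := by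
      linarith [sum_sdiff hS₀J (f := x)]
    obtain ⟨S, hdisj, hS⟩ := ih (fun i hi => hx i (sdiff_subset hi)) hrest
    have hdisj₀ j : Disjoint S₀ (S j) := disjoint_sdiff.mono_right (hS j).1
    refine ⟨Fin.cons S₀ S, pairwise_fin_succ_iff_of_isSymm.2 ⟨hdisj₀, hdisj⟩,
      Fin.cases ⟨hS₀J, hbS₀⟩ fun j => ⟨(hS j).1.trans sdiff_subset, (hS j).2⟩⟩

lemma integral_sumJMin_card_add_le {Ω : Type*} [MeasurableSpace Ω] {P : Measure Ω} {n : ℕ}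
    {Z : Fin n → Ω → ℝ} (hind : iIndepFun Z P) (hZ : ∀ i, Integrable (Z i) P)
    (hZ₀ : ∀ i ω, 0 ≤ Z i ω) {I J : Finset (Fin n)} (hIJ : Disjoint I J) {rate : Fin n → ℝ}
    (htail : ∀ i ∈ J, ∀ u > 0, P.real {ω | u < Z i ω} ≤ Real.exp (-(rate i * √u)))
    {b : ℝ} (hb : 0 < b) (hrate : ∀ i ∈ J, rate i ≤ b) {l : ℕ}
    (hl : 2 * b * l ≤ ∑ i ∈ J, rate i) :
    ∫ ω, sumJMin (#I + l) (fun i => Z i ω) ∂P ≤ ∑ i ∈ I, ∫ ω, Z i ω ∂P + l * (2 / b ^ 2) := by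
  obtain ⟨S, hdisj, hS⟩ := exists_disjoint_subsets_le_sum hb.le l hrate hl
  have hne j : (S j).Nonempty := nonempty_of_sum_ne_zero (hb.trans_le (hS j).2).ne'
  have hmin j : Integrable (fun ω => (S j).inf' (hne j) fun i => Z i ω) P :=
    integrable_inf' (hne j) fun i _ => hZ i
  have hsumI : Integrable (fun ω => ∑ i ∈ I, Z i ω) P := integrable_finsetSum I fun i _ => hZ i
  have hsumMin : Integrable (fun ω => ∑ j, (S j).inf' (hne j) fun i => Z i ω) P :=
    integrable_finsetSum univ fun j _ => hmin j
  calc ∫ ω, sumJMin (#I + l) (fun i => Z i ω) ∂P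
      ≤ ∫ ω, (∑ i ∈ I, Z i ω + ∑ j, (S j).inf' (hne j) fun i => Z i ω) ∂P := by
        refine integral_mono_of_nonneg (.of_forall fun ω => sumJMin_nonneg _ fun i => hZ₀ i ω)
          (hsumI.add hsumMin) (.of_forall fun ω => ?_)
        simpa only [Fintype.card_fin] using
          sumJMin_card_add_card_le (fun i => Z i ω) hne hdisj fun j => hIJ.mono_right (hS j).1
    _ = ∑ i ∈ I, ∫ ω, Z i ω ∂P + ∑ j, ∫ ω, (S j).inf' (hne j) (fun i => Z i ω) ∂P := by
        rw [integral_add hsumI hsumMin, integral_finsetSum I fun i _ => hZ i,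
          integral_finsetSum univ fun j _ => hmin j]
    _ ≤ ∑ i ∈ I, ∫ ω, Z i ω ∂P + ∑ _j : Fin l, 2 / b ^ 2 := by
        gcongr with j
        exact integral_inf'_le_of_measureReal_lt_le_exp_neg_sqrt hind (hne j) (fun i _ => hZ i)
          (fun i _ => hZ₀ i) (fun i hi => htail i ((hS j).1 hi)) hb (hS j).2
    _ = _ := by rw [sum_const, card_univ, Fintype.card_fin, nsmul_eq_mul]

/-! ### Upper bound for independent centred Gaussians -/

section Law

variable {Ω : Type*} [MeasurableSpace Ω] {P : Measure Ω}

lemma integrable_sq_of_hasLaw_gaussianReal {X : Ω → ℝ} {m : ℝ} {v : ℝ≥0}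
    (hX : HasLaw X (gaussianReal m v) P) : Integrable (fun ω => X ω ^ 2) P := by
  have hmap : Integrable (fun x => x ^ 2) (P.map X) := hX.map_eq ▸ integrable_sq_gaussianReal m v
  exact hmap.comp_aemeasurable hX.aemeasurable

lemma integral_sq_of_hasLaw_gaussianReal {X : Ω → ℝ} {v : ℝ≥0}
    (hX : HasLaw X (gaussianReal 0 v) P) : ∫ ω, X ω ^ 2 ∂P = v := by
  rw [← integral_sq_gaussianReal_zero v]
  exact hX.integral_comp (f := fun x => x ^ 2) (by fun_prop)

variable {n k : ℕ} {X : Fin n → Ω → ℝ} {v : Fin n → ℝ≥0}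

lemma integral_sumJMin_card_sq_le_sum (hX : ∀ i, HasLaw (X i) (gaussianReal 0 (v i)) P)
    (K : Finset (Fin n)) :
    ∫ ω, sumJMin #K (fun i => X i ω ^ 2) ∂P ≤ ∑ i ∈ K, (v i : ℝ) := by
  simpa only [integral_sq_of_hasLaw_gaussianReal (hX _)] using integral_sumJMin_card_le_sum
    (fun i => integrable_sq_of_hasLaw_gaussianReal (hX i)) K

lemma integral_sumJMin_card_add_sq_le (hX : ∀ i, HasLaw (X i) (gaussianReal 0 (v i)) P)
    (hind : iIndepFun X P) {I J : Finset (Fin n)} (hIJ : Disjoint I J) {t : ℝ} (ht : 0 < t)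
    (hJ : ∀ i ∈ J, 2 * t ≤ √(v i)) {l : ℕ} (hl : l ≤ ∑ i ∈ J, t / √(v i)) :
    ∫ ω, sumJMin (#I + l) (fun i => X i ω ^ 2) ∂P
      ≤ ∑ i ∈ I, (v i : ℝ) + l * (1152 * t ^ 2) := by
  have hbound := integral_sumJMin_card_add_le (Z := fun i ω => X i ω ^ 2)
    (rate := fun i => 1 / (12 * √(v i))) (b := 1 / (24 * t)) (l := l)
    (hind.comp (fun _ x => x ^ 2) fun _ => by fun_prop)
    (fun i => integrable_sq_of_hasLaw_gaussianReal (hX i))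
    (fun i ω => sq_nonneg _) hIJ
    (fun i _ u hu => measureReal_lt_sq_le_exp_of_hasLaw (hX i) hu.le) (by positivity)
    (fun i hi => one_div_le_one_div_of_le (by positivity) (by linarith [hJ i hi])) ?_
  · simp only [integral_sq_of_hasLaw_gaussianReal (hX _)] at hbound
    convert hbound using 3
    field_simp
    norm_num
  · calc 2 * (1 / (24 * t)) * l ≤ 2 * (1 / (24 * t)) * ∑ i ∈ J, t / √(v i) := by gcongr
      _ = ∑ i ∈ J, 1 / (12 * √(v i)) := by
        rw [mul_sum]
        refine sum_congr rfl fun i hi => ?_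
        have : 0 < √(v i) := by linarith [hJ i hi]
        field_simp
        norm_num

lemma integral_sumJMin_card_add_sq_le_add_sum_truncSecondMoment
    (hX : ∀ i, HasLaw (X i) (gaussianReal 0 (v i)) P) (hind : iIndepFun X P)
    {I J : Finset (Fin n)} (hIJ : Disjoint I J) {t : ℝ} (ht : 0 < t)
    (hJ : ∀ i ∈ J, 2 * t ≤ √(v i)) {l : ℕ} (hl : l ≤ ∑ i ∈ J, t / √(v i)) :
    ∫ ω, sumJMin (#I + l) (fun i => X i ω ^ 2) ∂P
      ≤ ∑ i ∈ I, (v i : ℝ) + 41472 * ∑ i ∈ J, truncSecondMoment (gaussianReal 0 (v i)) t :=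
  calc _ ≤ ∑ i ∈ I, (v i : ℝ) + l * (1152 * t ^ 2) :=
        integral_sumJMin_card_add_sq_le hX hind hIJ ht hJ hl
    _ ≤ ∑ i ∈ I, (v i : ℝ) + (∑ i ∈ J, t / √(v i)) * (1152 * t ^ 2) := by gcongr
    _ = ∑ i ∈ I, (v i : ℝ) + 1152 * ∑ i ∈ J, t ^ 2 * (t / √(v i)) := by
        rw [← mul_sum]
        ring
    _ ≤ ∑ i ∈ I, (v i : ℝ)
          + 1152 * ∑ i ∈ J, 36 * truncSecondMoment (gaussianReal 0 (v i)) t := by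
        gcongr _ + 1152 * ∑ i ∈ J, ?_ with i hi
        exact sq_mul_div_le_truncSecondMoment_gaussianReal ht.le (by linarith [hJ i hi])
    _ = _ := by
        rw [← mul_sum, ← mul_assoc]
        norm_num

lemma integral_sumJMin_sq_le_sum_truncSecondMoment
    (hX : ∀ i, HasLaw (X i) (gaussianReal 0 (v i)) P) (hind : iIndepFun X P) {t : ℝ} (ht : 0 < t)
    (htk : ∑ i, (gaussianReal 0 (v i)).real (Set.Icc (-t) t) = k) :
    ∫ ω, sumJMin k (fun i => X i ω ^ 2) ∂P
      ≤ 41472 * ∑ i, truncSecondMoment (gaussianReal 0 (v i)) t := by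
  set p : Fin n → ℝ := fun i => (gaussianReal 0 (v i)).real (Set.Icc (-t) t)
  set m : Fin n → ℝ := fun i => truncSecondMoment (gaussianReal 0 (v i)) t
  have hm (S : Finset (Fin n)) : 0 ≤ ∑ i ∈ S, m i :=
    sum_nonneg fun i _ => truncSecondMoment_nonneg _ t
  set I : Finset (Fin n) := {i | √(v i) ≤ 2 * t}
  set J : Finset (Fin n) := {i | ¬ √(v i) ≤ 2 * t}
  have hsplit (f : Fin n → ℝ) : ∑ i ∈ I, f i + ∑ i ∈ J, f i = ∑ i, f i :=
    sum_filter_add_sum_filter_not univ _ f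
  have hJ : ∀ i ∈ J, 2 * t < √(v i) := fun i hi => not_le.1 (mem_filter.1 hi).2
  have hmI : ∑ i ∈ I, (v i : ℝ) ≤ 288 * ∑ i ∈ I, m i := by
    rw [mul_sum]
    exact sum_le_sum fun i hi => le_mul_truncSecondMoment_gaussianReal (mem_filter.1 hi).2
  rcases le_total k #I with hk | hk
  · obtain ⟨K, hKI, rfl⟩ := exists_subset_card_eq hk
    have hK : ∑ i ∈ K, (v i : ℝ) ≤ ∑ i ∈ I, (v i : ℝ) :=
      sum_le_sum_of_subset_of_nonneg hKI fun i _ _ => (v i).coe_nonneg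
    linarith [integral_sumJMin_card_sq_le_sum hX K, hsplit m, hm I, hm J]
  · obtain ⟨l, rfl⟩ := Nat.exists_eq_add_of_le hk
    have hpI : ∑ i ∈ I, p i ≤ #I := by
      simpa using sum_le_card_nsmul I p 1 fun i _ => measureReal_le_one
    have hv : ∀ i ∈ J, v i ≠ 0 := fun i hi =>
      NNReal.coe_ne_zero.1 (Real.sqrt_pos.1 ((by positivity : 0 < 2 * t).trans (hJ i hi))).ne'
    have hpJ : ∑ i ∈ J, p i ≤ ∑ i ∈ J, t / √(v i) := sum_le_sum fun i hi =>
      measureReal_symmIcc_gaussianReal_le 0 (hv i hi) ht.le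
    have hl : (l : ℝ) ≤ ∑ i ∈ J, t / √(v i) := by
      push_cast at htk
      linarith [hsplit p]
    linarith [integral_sumJMin_card_add_sq_le_add_sum_truncSecondMoment hX hind
      (disjoint_filter_filter_not univ univ _) ht (fun i hi => (hJ i hi).le) hl, hsplit m, hm I]

end Law

/-! ### Doubly stochastic averaging of the variances -/

section DoublyStochastic

variable {ι : Type*} [Fintype ι] [DecidableEq ι] {W : Matrix ι ι ℝ}

lemma sum_map_mulVec_le_of_convexOn (hW : W ∈ doublyStochastic ℝ ι) {s : Set ℝ} {f : ℝ → ℝ}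
    (hf : ConvexOn ℝ s f) {v : ι → ℝ} (hv : ∀ j, v j ∈ s) :
    ∑ i, f ((W *ᵥ v) i) ≤ ∑ j, f (v j) :=
  calc ∑ i, f ((W *ᵥ v) i) ≤ ∑ i, ∑ j, W i j * f (v j) := sum_le_sum fun i _ =>
        hf.map_sum_le (fun _ _ => nonneg_of_mem_doublyStochastic hW)
          (sum_row_of_mem_doublyStochastic hW i) fun j _ => hv j
    _ = ∑ j, f (v j) := by
        rw [sum_comm]
        simp only [← sum_mul, sum_col_of_mem_doublyStochastic hW, one_mul]

lemma map_sq_mem_doublyStochastic {A : Matrix ι ι ℝ} (hA : A ∈ Matrix.orthogonalGroup ι ℝ) :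
    A.map (· ^ 2) ∈ doublyStochastic ℝ ι := by
  refine mem_doublyStochastic_iff_sum.2 ⟨fun i j => sq_nonneg _, fun i => ?_, fun j => ?_⟩
  · simpa [Matrix.mul_apply, sq] using
      congr_fun₂ ((Matrix.mem_orthogonalGroup_iff ι ℝ).1 hA) i i
  · simpa [Matrix.mul_apply, sq] using
      congr_fun₂ ((Matrix.mem_orthogonalGroup_iff' ι ℝ).1 hA) j j

lemma convexOn_integral_posPart_sub_mul {α : Type*} [MeasurableSpace α] {μ : Measure α}
    [IsFiniteMeasure μ] {g : α → ℝ} (hg : Integrable g μ) (c : ℝ) :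
    ConvexOn ℝ Set.univ fun v => ∫ x, max (c - v * g x) 0 ∂μ := by
  have hint (v : ℝ) : Integrable (fun x => max (c - v * g x) 0) μ :=
    ((integrable_const c).sub (hg.const_mul v)).pos_part
  refine ⟨convex_univ, fun u _ v _ a b ha hb hab => ?_⟩
  simp only [smul_eq_mul]
  rw [← integral_const_mul, ← integral_const_mul,
    ← integral_add ((hint u).const_mul a) ((hint v).const_mul b)]
  refine integral_mono (hint _) (((hint u).const_mul a).add ((hint v).const_mul b)) fun x => ?_
  have haff : c - (a * u + b * v) * g x = a * (c - u * g x) + b * (c - v * g x) := by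
    linear_combination (-c) * hab
  beta_reduce
  rw [haff]
  refine max_le (by gcongr <;> exact le_max_left _ _) (by positivity)

lemma integral_comp_sq_gaussianReal_zero {f : ℝ → ℝ} (hf : Measurable f) (v : ℝ≥0) :
    ∫ x, f (x ^ 2) ∂gaussianReal 0 v = ∫ x, f (v * x ^ 2) ∂gaussianReal 0 1 := by
  have hscale : gaussianReal 0 v = (gaussianReal 0 1).map (√v * ·) := by
    rw [gaussianReal_map_const_mul, mul_zero, mul_one]
    congr 1
    ext
    exact (Real.sq_sqrt v.coe_nonneg).symm
  rw [hscale, integral_map (by fun_prop) (Measurable.aestronglyMeasurable (by fun_prop))]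
  simp only [mul_pow, Real.sq_sqrt v.coe_nonneg]

lemma sum_integral_posPart_sub_sq_gaussianReal_le (hW : W ∈ doublyStochastic ℝ ι) {v w : ι → ℝ≥0}
    (hw : ∀ i, (w i : ℝ) = ∑ j, W i j * v j) (c : ℝ) :
    ∑ i, ∫ x, max (c - x ^ 2) 0 ∂gaussianReal 0 (w i)
      ≤ ∑ j, ∫ x, max (c - x ^ 2) 0 ∂gaussianReal 0 (v j) := by
  have hscale (u : ℝ≥0) : ∫ x, max (c - x ^ 2) 0 ∂gaussianReal 0 u
      = ∫ x, max (c - u * x ^ 2) 0 ∂gaussianReal 0 1 :=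
    integral_comp_sq_gaussianReal_zero (f := fun y => max (c - y) 0) (by fun_prop) u
  simp only [hscale, hw]
  exact sum_map_mulVec_le_of_convexOn hW
    (convexOn_integral_posPart_sub_mul (integrable_sq_gaussianReal 0 1) c)
    (v := fun j => (v j : ℝ)) fun _ => Set.mem_univ _

end DoublyStochastic

/-! ### The comparison theorem -/

section Comparison

variable {Ω Ω' : Type*} [MeasurableSpace Ω] [MeasurableSpace Ω'] {P : Measure Ω}
  {P' : Measure Ω'} {n k : ℕ}

lemma mul_sub_sum_integral_posPart_le_integral_sumJMin_sq [IsProbabilityMeasure P] (hk : k ≤ n)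
    {Y : Fin n → Ω → ℝ} {w : Fin n → ℝ≥0} (hY : ∀ i, HasLaw (Y i) (gaussianReal 0 (w i)) P)
    (c : ℝ) :
    k * c - ∑ i, ∫ x, max (c - x ^ 2) 0 ∂gaussianReal 0 (w i)
      ≤ ∫ ω, sumJMin k (fun i => Y i ω ^ 2) ∂P := by
  have hlaw i : ∫ ω, max (c - Y i ω ^ 2) 0 ∂P = ∫ x, max (c - x ^ 2) 0 ∂gaussianReal 0 (w i) :=
    (hY i).integral_comp (f := fun x => max (c - x ^ 2) 0) (by fun_prop)
  simpa only [hlaw] using mul_sub_sum_integral_posPart_le_integral_sumJMin hk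
    (fun i => integrable_sq_of_hasLaw_gaussianReal (hY i)) c

theorem mainTheorem1_general [IsProbabilityMeasure P'] (hkn : k < n) {X : Fin n → Ω → ℝ}
    {Y : Fin n → Ω' → ℝ} {v w : Fin n → ℝ≥0} (hX : ∀ i, HasLaw (X i) (gaussianReal 0 (v i)) P)
    (hind : iIndepFun X P) (hY : ∀ i, HasLaw (Y i) (gaussianReal 0 (w i)) P')
    {W : Matrix (Fin n) (Fin n) ℝ} (hW : W ∈ doublyStochastic ℝ (Fin n))
    (hw : ∀ i, (w i : ℝ) = ∑ j, W i j * v j) :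
    Integrable (fun ω => sumJMin k fun i => X i ω ^ 2) P ∧
      Integrable (fun ω => sumJMin k fun i => Y i ω ^ 2) P' ∧
      ∫ ω, sumJMin k (fun i => X i ω ^ 2) ∂P
        ≤ 41472 * ∫ ω, sumJMin k (fun i => Y i ω ^ 2) ∂P' := by
  refine ⟨integrable_sumJMin hkn.le fun i => integrable_sq_of_hasLaw_gaussianReal (hX i),
    integrable_sumJMin hkn.le fun i => integrable_sq_of_hasLaw_gaussianReal (hY i), ?_⟩
  rcases le_or_gt k #{i | v i = 0} with hk | hk
  · obtain ⟨K, hK, rfl⟩ := exists_subset_card_eq hk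
    calc ∫ ω, sumJMin #K (fun i => X i ω ^ 2) ∂P ≤ ∑ i ∈ K, (v i : ℝ) :=
          integral_sumJMin_card_sq_le_sum hX K
      _ = 0 := sum_eq_zero fun i hi => NNReal.coe_eq_zero.2 (mem_filter.1 (hK hi)).2
      _ ≤ _ := mul_nonneg (by norm_num)
          (integral_nonneg fun ω => sumJMin_nonneg _ fun i => sq_nonneg _)
  · obtain ⟨t, ht, htk⟩ := exists_sum_measureReal_symmIcc_gaussianReal_eq hk (by simpa using hkn)
    refine (integral_sumJMin_sq_le_sum_truncSecondMoment hX hind ht htk).trans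
      (mul_le_mul_of_nonneg_left ?_ (by norm_num))
    calc ∑ i, truncSecondMoment (gaussianReal 0 (v i)) t
        = k * t ^ 2 - ∑ i, ∫ x, max (t ^ 2 - x ^ 2) 0 ∂gaussianReal 0 (v i) := by
          simp only [integral_posPart_sq_sub_sq (integrable_sq_gaussianReal 0 _) ht.le,
            sum_sub_distrib, ← mul_sum, htk]
          ring
      _ ≤ k * t ^ 2 - ∑ i, ∫ x, max (t ^ 2 - x ^ 2) 0 ∂gaussianReal 0 (w i) :=
          sub_le_sub_left (sum_integral_posPart_sub_sq_gaussianReal_le hW hw _) _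
      _ ≤ _ := mul_sub_sum_integral_posPart_le_integral_sumJMin_sq hkn.le hY _

end Comparison

/-! ### Orthogonal transformations -/

lemma exists_mem_orthogonalGroup_forall_apply_eq_mulVec {ι : Type*} [Fintype ι] [DecidableEq ι]
    (T : EuclideanSpace ℝ ι ≃ₗᵢ[ℝ] EuclideanSpace ℝ ι) :
    ∃ A ∈ Matrix.orthogonalGroup ι ℝ, ∀ x i, T x i = (A *ᵥ x) i := by
  set b := EuclideanSpace.basisFun ι ℝ
  exact ⟨_, T.toMatrix_mem_unitaryGroup b b, fun x i =>
    (congr_fun (LinearMap.toMatrix_mulVec_repr b.toBasis b.toBasis T.toLinearMap x) i).symm⟩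

section GaussianLaw

variable {Ω : Type*} [MeasurableSpace Ω] {P : Measure Ω}

lemma hasLaw_gaussianReal_of_hasGaussianLaw {X : Ω → ℝ} (hX : HasGaussianLaw X P) :
    HasLaw X (gaussianReal P[X] Var[X; P].toNNReal) P :=
  ⟨hX.aemeasurable, hX.map_eq_gaussianReal⟩

variable {ι : Type*} {X : ι → Ω → ℝ} {m : ι → ℝ} {v : ι → ℝ≥0}

lemma hasLaw_sum_gaussianReal (hX : ∀ i, HasLaw (X i) (gaussianReal (m i) (v i)) P)
    (hind : iIndepFun X P) (S : Finset ι) :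
    HasLaw (∑ i ∈ S, X i) (gaussianReal (∑ i ∈ S, m i) (∑ i ∈ S, v i)) P := by
  classical
  have := hind.isProbabilityMeasure
  refine ⟨aemeasurable_sum S fun i _ => (hX i).aemeasurable, ?_⟩
  induction S using Finset.induction_on with
  | empty => simp [Pi.zero_def]
  | insert i S hi ih =>
    simp only [sum_insert hi]
    exact gaussianReal_add_gaussianReal_of_indepFun
      (hind.indepFun_finsetSum_of_notMem₀ (fun i => (hX i).aemeasurable) hi).symm
      (hX i).map_eq ih

lemma hasLaw_mulVec_gaussianReal {κ : Type*} [Fintype ι]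
    (hX : ∀ i, HasLaw (X i) (gaussianReal 0 (v i)) P) (hind : iIndepFun X P) (A : Matrix κ ι ℝ)
    (i : κ) : HasLaw (fun ω => (A *ᵥ fun j => X j ω) i)
      (gaussianReal 0 (∑ j, NNReal.mk (A i j ^ 2) (sq_nonneg _) * v j)) P := by
  have hterm j : HasLaw (fun ω => A i j * X j ω)
      (gaussianReal 0 (NNReal.mk (A i j ^ 2) (sq_nonneg _) * v j)) P := by
    simpa only [mul_zero] using gaussianReal_const_mul (hX j) (A i j)
  simpa [Matrix.mulVec, dotProduct, sum_fn] using hasLaw_sum_gaussianReal hterm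
    (hind.comp (fun j x => A i j * x) fun j => measurable_const_mul _) univ

end GaussianLaw

theorem mainTheorem1 :
    ∃ C : ℝ, 0 < C ∧
      ∀ (n k : ℕ), 1 ≤ k → k < n →
      ∀ (Ω : Type*) [MeasurableSpace Ω] (P : Measure Ω) [IsProbabilityMeasure P]
        (X : Ω → EuclideanSpace ℝ (Fin n)),
        HasGaussianLaw X P →
        (∀ i, ∫ ω, X ω i ∂P = 0) →
        iIndepFun (fun i ω => X ω i) P →
      ∀ (T : EuclideanSpace ℝ (Fin n) ≃ₗᵢ[ℝ] EuclideanSpace ℝ (Fin n)),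
        Integrable (fun ω => sumJMin k (fun i => (X ω i) ^ 2)) P ∧
        Integrable (fun ω => sumJMin k (fun i => (T (X ω) i) ^ 2)) P ∧
        (∫ ω, sumJMin k (fun i => (X ω i) ^ 2) ∂P)
          ≤ C * (∫ ω, sumJMin k (fun i => (T (X ω) i) ^ 2) ∂P) := by
  refine ⟨41472, by norm_num, fun n k _ hkn Ω _ P _ X hX h₀ hind T => ?_⟩
  obtain ⟨A, hA, hTA⟩ := exists_mem_orthogonalGroup_forall_apply_eq_mulVec T
  have hlaw i : HasLaw (fun ω => X ω i) (gaussianReal 0 Var[fun ω => X ω i; P].toNNReal) P :=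
    h₀ i ▸ hasLaw_gaussianReal_of_hasGaussianLaw (hX.map_fun (EuclideanSpace.proj i))
  simp only [hTA]
  exact mainTheorem1_general hkn hlaw hind (hasLaw_mulVec_gaussianReal hlaw hind A)
    (map_sq_mem_doublyStochastic hA) fun i => by simp
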